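/- **Theorem 3.11.** Let $n\ge 0$. A *cone* is a non-empty open set $V\subset\mathbb R^n$ with $\lambda x\in V$ and $x+y\in V$ for all $x,y\in V$, $\lambda>0$, and such that $-x\notin\overline V$ whenever $0\ne x\in\overline V$. Let $G(V)$ be the group of all $n\times n$ matrices that map $V$ onto $V$; the cone $V$ is *homogeneous* if $G(V)$ acts transitively on it. The dual cone is $V^*=\{x: x\cdot y>0 \text{ for every } y\in\overline V,\ y\ne 0\}$. For a cone $V$ and $x\in V$, let $\Delta_V(x)$ be the Lebesgue measure of $\{y\in V: x-y\in V\}$. Let $V$ be a homogeneous cone, $1\le p<\infty$, $\frac1p+\frac1{p'}=1$, $\beta\in\mathbb R$, and let $k:V^*\times V\to[0,\infty)$ be a kernel such that $k(x,\cdot)$ is measurable for every $x\in V^*$ and which is $V^*\times V$-homogeneous of order $\beta$, that is, $$k\big((A^t)^{-1}x,\,Ay\big)=|\det A|^{\beta}\,k(x,y)\qquad\text{for all }A\in G(V),\ x\in V^*,\ y\in V.$$ Suppose that for every $x\in V^*$ $$\int_V k^{p'}(x,y)\,\Delta_V^{(1-\beta)p'-1}(y)\,dy<\infty ,$$ where for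 $p=1$ (so $p'=\infty$) this condition is read as $\operatorname{ess\,sup}_{y\in V}k(x,y)\,\Delta_V^{1-\beta}(y)<\infty$. Put $Kf(x)=\int_V k(x,y)f(y)\,dy$. Then there is a finite constant $c$, independent of $f$, such that for every measurable $f:V\to[0,\infty)$ $$\operatorname*{ess\,sup}_{x\in V^*}\ \Delta_{V^*}(x)\,Kf(x)\ \le\ c\left(\int_V f^p(y)\,\Delta_V^{\beta p-1}(y)\,dy\right)^{1/p},$$ both sides being understood in $[0,\infty]$. -/

import Mathlib

open MeasureTheory
open scoped ENNReal NNReal InnerProductSpace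

namespace HomCone

/-- Euclidean space of dimension `n`. -/
abbrev Euc (n : ℕ) : Type := EuclideanSpace ℝ (Fin n)

/-- A cone: a nonempty open subset `V` of Euclidean space that is stable under positive dilations
and under addition, and whose closure contains no pair `x, -x` with `x ≠ 0`. -/
structure IsCone {n : ℕ} (V : Set (Euc n)) : Prop where
  nonempty : V.Nonempty
  isOpen : IsOpen V
  smul_mem : ∀ x ∈ V, ∀ r : ℝ, 0 < r → r • x ∈ V
  add_mem : ∀ x ∈ V, ∀ y ∈ V, x + y ∈ V
  pointed : ∀ x ∈ closure V, x ≠ 0 → -x ∉ closure V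

/-- The automorphism group `G(V)`: all matrices that map `V` onto `V`. -/
def autGroup {n : ℕ} (V : Set (Euc n)) : Set (Matrix (Fin n) (Fin n) ℝ) :=
  {A | Matrix.toEuclideanLin A '' V = V}

/-- A homogeneous cone: a cone on which `G(V)` acts transitively. -/
structure IsHomogeneousCone {n : ℕ} (V : Set (Euc n)) : Prop extends IsCone V where
  transitive : ∀ x ∈ V, ∀ y ∈ V, ∃ A ∈ autGroup V, Matrix.toEuclideanLin A x = y

/-- The dual cone `V* = {x | x ⬝ y > 0 for every y ∈ closure V, y ≠ 0}`. -/
def dualCone {n : ℕ} (V : Set (Euc n)) : Set (Euc n) :=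
  {x | ∀ y ∈ closure V, y ≠ 0 → 0 < ⟪x, y⟫_ℝ}

/-- The cone interval `⟨a, b⟩ = {x ∈ V | a <_V x <_V b}`, where `x <_V y` means `y - x ∈ V`. -/
def coneInterval {n : ℕ} (V : Set (Euc n)) (a b : Euc n) : Set (Euc n) :=
  {x | x ∈ V ∧ x - a ∈ V ∧ b - x ∈ V}

/-- `Δ_V(x)`: the Lebesgue measure of the cone interval `⟨0, x⟩`. -/
noncomputable def coneDelta {n : ℕ} (V : Set (Euc n)) (x : Euc n) : ℝ≥0∞ :=
  volume (coneInterval V 0 x)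

/-- `k : V* × V → [0, ∞)` is `V* × V`-homogeneous of order `β`:
`k ((Aᵗ)⁻¹ x, A y) = |det A| ^ β * k (x, y)` for all `A ∈ G(V)`. Only the values of `k` on
`V* × V` matter. -/
def IsDualHomogeneousKernel {n : ℕ} (V : Set (Euc n)) (β : ℝ) (k : Euc n → Euc n → ℝ≥0) : Prop :=
  ∀ A ∈ autGroup V, ∀ x ∈ dualCone V, ∀ y ∈ V,
    k (Matrix.toEuclideanLin (A.transpose)⁻¹ x) (Matrix.toEuclideanLin A y)
      = Real.nnabs A.det ^ β * k x y

/-- The integral operator `K f (x) = ∫_V k(x, y) f(y) dy`, with values in `[0, ∞]`. -/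
noncomputable def kernelOp {n : ℕ} (V : Set (Euc n)) (k : Euc n → Euc n → ℝ≥0) (f : Euc n → ℝ≥0)
    (x : Euc n) : ℝ≥0∞ :=
  ∫⁻ y in V, (k x y : ℝ≥0∞) * (f y : ℝ≥0∞)

/-- Finiteness, at every `x ∈ V*`, of the integral
`∫_V k(x, y) ^ p' * Δ_V(y) ^ ((1 - β) p' - 1) dy`, where `1/p + 1/p' = 1`. For `p = 1`, that is
`p' = ∞`, this is the finiteness of the `L^∞` norm of `y ↦ k(x, y) * Δ_V(y) ^ (1 - β)`, since for
`p > 1` the integral is the `p'`-th power of the `L^{p'}` norm of that function with respect to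
the measure `Δ_V(y)⁻¹ dy`. -/
def KernelCondition {n : ℕ} (V : Set (Euc n)) (p β : ℝ) (k : Euc n → Euc n → ℝ≥0) : Prop :=
  (1 < p → ∀ x ∈ dualCone V,
    ∫⁻ y in V, (k x y : ℝ≥0∞) ^ (p / (p - 1))
      * coneDelta V y ^ ((1 - β) * (p / (p - 1)) - 1) < ∞) ∧
  (p = 1 → ∀ x ∈ dualCone V,
    essSup (fun y => (k x y : ℝ≥0∞) * coneDelta V y ^ (1 - β)) (volume.restrict V) < ∞)

end HomCone

namespace HomCone

variable {n : ℕ} {V : Set (Euc n)}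

/-! The group `G(V)` acts on the dual cone `V*` by `ξ ↦ (Aᵗ)⁻¹ξ`, and the estimate is invariant:
`Δ_{V*}` scales by `|det A|⁻¹`, `Kf` at the moved point is `|det A|^(1+β)` times `K(f ∘ A)` at the
old one, and the norm of `f` is `|det A|^β` times that of `f ∘ A`. If the action is transitive, a
bound at one point `ξ₀` suffices, and there it is Hölder's inequality (`IsCone.exists_kernelOp_le`).

The real content is transitivity (`IsHomogeneousCone.exists_contragredient_eq`). Let `φ(ξ) = ∫_V
exp(-ξ·y) dy`. It is strictly convex on `V*`, decreases strictly along functionals nonnegative on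
`V`, and is multiplied by `|det A|` under the action. So each `ξ` is the unique minimiser of `φ` on
a hyperplane slice with normal in `V` (`IsCone.exists_mem_forall_lt`). Transitivity on `V` matches
the normals, a dilation matches the slices, and uniqueness then matches the minimisers. -/

/-! ### Convexity, coercivity and openness of the dual cone -/

lemma IsCone.convex (hV : IsCone V) : Convex ℝ V := by
  rw [convex_iff_forall_pos]
  intro x hx y hy a b ha hb _
  exact hV.add_mem _ (hV.smul_mem x hx a ha) _ (hV.smul_mem y hy b hb)

lemma IsCone.smul_mem_closure (hV : IsCone V) {x : Euc n} (hx : x ∈ closure V) {r : ℝ}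
    (hr : 0 < r) : r • x ∈ closure V :=
  map_mem_closure (continuous_const_smul r) hx fun y hy => hV.smul_mem y hy r hr

/-- A functional in the dual cone is coercive on the closure of the cone. -/
lemma IsCone.exists_pos_mul_norm_le (hV : IsCone V) {ξ : Euc n} (hξ : ξ ∈ dualCone V) :
    ∃ c > 0, ∀ y ∈ closure V, c * ‖y‖ ≤ ⟪ξ, y⟫_ℝ := by
  have hK : IsCompact (closure V ∩ Metric.sphere 0 1) :=
    (isCompact_sphere 0 1).inter_left isClosed_closure
  rcases (closure V ∩ Metric.sphere (0 : Euc n) 1).eq_empty_or_nonempty with he | hne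
  · refine ⟨1, one_pos, fun y hy => ?_⟩
    by_cases h0 : y = 0
    · simp [h0]
    · have : ‖y‖⁻¹ • y ∈ closure V ∩ Metric.sphere (0 : Euc n) 1 :=
        ⟨hV.smul_mem_closure hy (by positivity), by simp [norm_smul, h0]⟩
      simp [he] at this
  · obtain ⟨z, hz, hmin⟩ := hK.exists_isMinOn hne
      (f := fun y => ⟪ξ, y⟫_ℝ) (by fun_prop)
    have hz0 : z ≠ 0 := by
      rintro rfl
      simpa using hz.2
    refine ⟨⟪ξ, z⟫_ℝ, hξ z hz.1 hz0, fun y hy => ?_⟩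
    by_cases h0 : y = 0
    · simp [h0]
    · have hn : 0 < ‖y‖ := norm_pos_iff.2 h0
      have : ‖y‖⁻¹ • y ∈ closure V ∩ Metric.sphere (0 : Euc n) 1 :=
        ⟨hV.smul_mem_closure hy (by positivity), by simp [norm_smul, h0]⟩
      have := hmin this
      simp only [Set.mem_ofPred_eq, inner_smul_right] at this
      rwa [← div_eq_inv_mul, le_div_iff₀ hn] at this

lemma inner_nonneg_of_mem_closure {ζ : Euc n} (h : ∀ y ∈ V, 0 ≤ ⟪ζ, y⟫_ℝ) :
    ∀ y ∈ closure V, 0 ≤ ⟪ζ, y⟫_ℝ := by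
  intro y hy
  have : IsClosed {y : Euc n | 0 ≤ ⟪ζ, y⟫_ℝ} := isClosed_le continuous_const (by fun_prop)
  exact closure_minimal h this hy

lemma add_mem_dualCone {ξ ζ : Euc n} (hξ : ξ ∈ dualCone V) (h : ∀ y ∈ V, 0 ≤ ⟪ζ, y⟫_ℝ) :
    ξ + ζ ∈ dualCone V := by
  intro y hy h0
  rw [inner_add_left]
  exact add_pos_of_pos_of_nonneg (hξ y hy h0) (inner_nonneg_of_mem_closure h y hy)

lemma inner_nonneg_of_mem_dualCone {ξ y : Euc n} (hξ : ξ ∈ dualCone V) (hy : y ∈ V) :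
    0 ≤ ⟪ξ, y⟫_ℝ := by
  by_cases h0 : y = 0
  · simp [h0]
  · exact (hξ y (subset_closure hy) h0).le

lemma smul_mem_dualCone {ξ : Euc n} (hξ : ξ ∈ dualCone V) {r : ℝ} (hr : 0 < r) :
    r • ξ ∈ dualCone V := by
  intro y hy h0
  rw [real_inner_smul_left]
  exact mul_pos hr (hξ y hy h0)

lemma convex_dualCone : Convex ℝ (dualCone V) := by
  rw [convex_iff_forall_pos]
  intro x hx y hy a b ha hb _
  exact add_mem_dualCone (smul_mem_dualCone hx ha) fun z hz =>
    inner_nonneg_of_mem_dualCone (smul_mem_dualCone hy hb) hz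

lemma IsCone.isOpen_dualCone (hV : IsCone V) : IsOpen (dualCone V) := by
  rw [Metric.isOpen_iff]
  intro ξ hξ
  obtain ⟨c, hc, h⟩ := hV.exists_pos_mul_norm_le hξ
  refine ⟨c, hc, fun η hη y hy h0 => ?_⟩
  have h1 : |⟪η - ξ, y⟫_ℝ| ≤ ‖η - ξ‖ * ‖y‖ := abs_real_inner_le_norm _ _
  have h2 : ‖η - ξ‖ * ‖y‖ < c * ‖y‖ :=
    mul_lt_mul_of_pos_right (by simpa [dist_eq_norm] using hη) (norm_pos_iff.2 h0)
  have h3 := h y hy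
  rw [inner_sub_left] at h1
  have := (abs_le.1 h1).1
  linarith

/-- Openness of `V` allows a small step along `u`, which changes the pairing by `t‖u‖²`. This
supplies the strict inequalities for `φ`. -/
lemma IsCone.exists_inner_ne_zero (hV : IsCone V) {u : Euc n} (hu : u ≠ 0) :
    ∃ y ∈ V, ⟪u, y⟫_ℝ ≠ 0 := by
  by_contra! h
  obtain ⟨y, hy⟩ := hV.nonempty
  have hc : Filter.Tendsto (fun t : ℝ => y + t • u) (nhds 0) (nhds y) := by
    have : Continuous fun t : ℝ => y + t • u := by fun_prop
    simpa using this.tendsto 0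
  have hev : ∀ᶠ t : ℝ in nhdsWithin 0 (Set.Ioi 0), y + t • u ∈ V :=
    (hc.eventually (hV.isOpen.mem_nhds hy)).filter_mono nhdsWithin_le_nhds
  obtain ⟨t, ht, ht0⟩ := (hev.and self_mem_nhdsWithin).exists
  have h1 := h _ ht
  rw [inner_add_right, h y hy, inner_smul_right, zero_add] at h1
  rcases mul_eq_zero.1 h1 with h2 | h2
  · exact (ne_of_gt ht0) h2
  · exact hu (inner_self_eq_zero.1 h2)

/-- Strict monotonicity of the integral over an open set, for continuous integrands. -/
lemma setIntegral_lt_of_continuous (hV : IsOpen V) {f g : Euc n → ℝ} (hf : Continuous f)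
    (hg : Continuous g) (hfi : IntegrableOn f V) (hgi : IntegrableOn g V)
    (hle : ∀ y ∈ V, f y ≤ g y) (hlt : ∃ y ∈ V, f y < g y) :
    ∫ y in V, f y < ∫ y in V, g y := by
  have hi : IntegrableOn (fun y => g y - f y) V := hgi.sub hfi
  rw [← sub_pos, ← integral_sub hgi hfi, setIntegral_pos_iff_support_of_nonneg_ae _ hi]
  · obtain ⟨y, hy, h⟩ := hlt
    have ho : IsOpen (Function.support (fun y => g y - f y) ∩ V) :=
      (hg.sub hf).isOpen_support.inter hV
    exact ho.measure_pos _ ⟨y, by simpa using (sub_pos.2 h).ne', hy⟩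
  · exact ae_restrict_of_forall_mem hV.measurableSet fun y hy => sub_nonneg.2 (hle y hy)

/-! ### The characteristic function and its minimisers on slices -/

/-- The characteristic function (Koecher norm) of the dual cone. -/
noncomputable def dualChar (V : Set (Euc n)) (ξ : Euc n) : ℝ :=
  ∫ y in V, Real.exp (-⟪ξ, y⟫_ℝ)

lemma integrable_exp_neg_mul_norm {c : ℝ} (hc : 0 < c) :
    Integrable fun y : Euc n => Real.exp (-(c * ‖y‖)) := by
  -- The exponent `n + 1` exceeds the dimension; the constant comes from one term of the series of
  -- `exp (c(1 + ‖y‖))`.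
  have h := (integrable_one_add_norm (E := Euc n) (μ := volume) (r := ((n + 1 : ℕ) : ℝ))
    (by simp)).const_mul (Real.exp c * (n + 1).factorial / c ^ (n + 1))
  refine h.mono' (by fun_prop) (Filter.Eventually.of_forall fun y => ?_)
  have h1 := Real.pow_div_factorial_le_exp (x := c * (1 + ‖y‖)) (by positivity) (n + 1)
  rw [Real.norm_eq_abs, Real.abs_exp, Real.rpow_neg (by positivity), Real.rpow_natCast,
    Real.exp_neg]
  rw [mul_pow, mul_add, Real.exp_add, mul_one] at h1
  have hy : 0 < (1 + ‖y‖) ^ (n + 1) := by positivity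
  rw [← div_eq_mul_inv, inv_eq_one_div, div_div, div_le_div_iff₀ (by positivity) (by positivity)]
  rw [div_le_iff₀ (by positivity)] at h1
  nlinarith

lemma IsCone.integrableOn_exp (hV : IsCone V) {ξ : Euc n} (hξ : ξ ∈ dualCone V) :
    IntegrableOn (fun y => Real.exp (-⟪ξ, y⟫_ℝ)) V := by
  obtain ⟨c, hc, h⟩ := hV.exists_pos_mul_norm_le hξ
  refine (integrable_exp_neg_mul_norm hc).integrableOn.mono'
    (by fun_prop) (ae_restrict_of_forall_mem hV.isOpen.measurableSet fun y hy => ?_)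
  rw [Real.norm_eq_abs, Real.abs_exp]
  exact Real.exp_le_exp.2 (neg_le_neg (h y (subset_closure hy)))

lemma IsCone.strictConvexOn_dualChar (hV : IsCone V) :
    StrictConvexOn ℝ (dualCone V) (dualChar V) := by
  refine ⟨convex_dualCone, fun ξ hξ η hη hne a b ha hb hab => ?_⟩
  have hξi := hV.integrableOn_exp hξ
  have hηi := hV.integrableOn_exp hη
  simp only [dualChar, smul_eq_mul]
  rw [← integral_const_mul, ← integral_const_mul,
    ← integral_add (hξi.const_mul a) (hηi.const_mul b)]
  have key : ∀ y, -⟪a • ξ + b • η, y⟫_ℝ = a • (-⟪ξ, y⟫_ℝ) + b • (-⟪η, y⟫_ℝ) := by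
    intro y
    simp only [inner_add_left, real_inner_smul_left, smul_eq_mul]
    ring
  refine setIntegral_lt_of_continuous hV.isOpen (by fun_prop) (by fun_prop)
    (hV.integrableOn_exp (convex_dualCone hξ hη ha.le hb.le hab))
    ((hξi.const_mul a).add (hηi.const_mul b)) (fun y _ => ?_) ?_
  · rw [key]
    exact convexOn_exp.2 trivial trivial ha.le hb.le hab
  · obtain ⟨y, hy, h⟩ := hV.exists_inner_ne_zero (sub_ne_zero.2 hne)
    refine ⟨y, hy, ?_⟩
    rw [key]
    refine strictConvexOn_exp.2 trivial trivial (fun he => h ?_) ha hb hab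
    rw [inner_sub_left]
    linarith

lemma IsCone.dualChar_add_lt (hV : IsCone V) {ξ ζ : Euc n} (hξ : ξ ∈ dualCone V)
    (h : ∀ y ∈ V, 0 ≤ ⟪ζ, y⟫_ℝ) (h0 : ζ ≠ 0) : dualChar V (ξ + ζ) < dualChar V ξ := by
  refine setIntegral_lt_of_continuous hV.isOpen (by fun_prop) (by fun_prop)
    (hV.integrableOn_exp (add_mem_dualCone hξ h)) (hV.integrableOn_exp hξ) (fun y hy => ?_) ?_
  · rw [Real.exp_le_exp, inner_add_left]
    linarith [h y hy]
  · obtain ⟨y, hy, hne⟩ := hV.exists_inner_ne_zero h0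
    refine ⟨y, hy, ?_⟩
    rw [Real.exp_lt_exp, inner_add_left]
    linarith [(h y hy).lt_of_ne' hne]

lemma IsCone.isOpen_dualChar_lt (hV : IsCone V) (r : ℝ) :
    IsOpen {η ∈ dualCone V | dualChar V η < r} :=
  (hV.strictConvexOn_dualChar.convexOn.continuousOn hV.isOpen_dualCone).isOpen_inter_preimage
    hV.isOpen_dualCone isOpen_Iio

/-- A point outside the cone is separated from it by a nonzero functional that is nonnegative on
the cone. -/
lemma IsCone.exists_nonneg_inner_nonpos (hV : IsCone V) {x : Euc n} (hx : x ∉ V) :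
    ∃ ζ : Euc n, ζ ≠ 0 ∧ (∀ y ∈ V, 0 ≤ ⟪ζ, y⟫_ℝ) ∧ ⟪ζ, x⟫_ℝ ≤ 0 := by
  obtain ⟨f, hf⟩ := geometric_hahn_banach_point_open hV.convex hV.isOpen hx
  obtain ⟨ζ, rfl⟩ := (InnerProductSpace.toDual ℝ (Euc n)).surjective f
  simp only [InnerProductSpace.toDual_apply_apply] at hf
  refine ⟨ζ, ?_, fun y hy => ?_, ?_⟩
  · rintro rfl
    obtain ⟨y, hy⟩ := hV.nonempty
    simpa using hf y hy
  · by_contra! hneg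
    -- A large dilate of `y` would push the pairing below `⟪ζ, x⟫`.
    obtain ⟨t, ht⟩ := exists_gt (max 0 (⟪ζ, x⟫_ℝ / ⟪ζ, y⟫_ℝ))
    have h1 := hf _ (hV.smul_mem y hy t ((le_max_left _ _).trans_lt ht))
    rw [inner_smul_right] at h1
    have h2 := (le_max_right _ _).trans_lt ht
    rw [div_lt_iff_of_neg hneg] at h2
    linarith
  · obtain ⟨y, hy⟩ := hV.nonempty
    have hc : Filter.Tendsto (fun t : ℝ => t * ⟪ζ, y⟫_ℝ) (nhdsWithin 0 (Set.Ioi 0)) (nhds 0) := by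
      have : Continuous fun t : ℝ => t * ⟪ζ, y⟫_ℝ := by fun_prop
      simpa using (this.tendsto 0).mono_left nhdsWithin_le_nhds
    refine ge_of_tendsto hc (eventually_nhdsWithin_of_forall fun t ht => ?_)
    have := hf _ (hV.smul_mem y hy t ht)
    rw [inner_smul_right] at this
    exact this.le

/-- Every point of the dual cone is the unique minimiser of the characteristic function on a
slice of the dual cone by a hyperplane with normal vector in the cone. -/
lemma IsCone.exists_mem_forall_lt (hV : IsCone V) {ξ : Euc n} (hξ : ξ ∈ dualCone V) :
    ∃ x ∈ V, ∀ η ∈ dualCone V, ⟪x, η⟫_ℝ = ⟪x, ξ⟫_ℝ → η ≠ ξ → dualChar V ξ < dualChar V η := by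
  -- The normal `x` comes from separating `ξ` from the open convex set `{φ < φ(ξ)}`.
  obtain ⟨f, hf⟩ := geometric_hahn_banach_point_open
    (hV.strictConvexOn_dualChar.convexOn.convex_lt (dualChar V ξ))
    (hV.isOpen_dualChar_lt (dualChar V ξ)) (x := ξ) (fun h => lt_irrefl _ h.2)
  obtain ⟨x, rfl⟩ := (InnerProductSpace.toDual ℝ (Euc n)).surjective f
  simp only [InnerProductSpace.toDual_apply_apply] at hf
  refine ⟨x, ?_, fun η hη he hne => ?_⟩
  -- If `x ∉ V`, some `ζ` lowers `φ` without raising the pairing with `x`, against the separation.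
  · by_contra hx
    obtain ⟨ζ, h0, hζ, hζx⟩ := hV.exists_nonneg_inner_nonpos hx
    have := hf (ξ + ζ) ⟨add_mem_dualCone hξ hζ, hV.dualChar_add_lt hξ hζ h0⟩
    rw [inner_add_right, real_inner_comm] at this
    rw [real_inner_comm] at hζx
    rw [real_inner_comm] at this
    linarith
  -- The midpoint of `ξ` and `η` would lie in the strict sublevel set and still on the slice.
  · by_contra! hle
    have hh : (0 : ℝ) < 1 / 2 := by norm_num
    have hm := hV.strictConvexOn_dualChar.2 hη hξ hne hh hh (by norm_num)
    have := hf _ ⟨convex_dualCone hη hξ hh.le hh.le (by norm_num), hm.trans_le (by simp only [smul_eq_mul]; linarith)⟩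
    rw [inner_add_right, inner_smul_right, inner_smul_right, he] at this
    linarith

/-! ### The automorphism group and its contragredient action -/

open Matrix in
lemma toEuclideanLin_mul_apply (A B : Matrix (Fin n) (Fin n) ℝ) (x : Euc n) :
    toEuclideanLin (A * B) x = toEuclideanLin A (toEuclideanLin B x) := by
  rw [toLpLin_mul_same]
  rfl

open Matrix in
lemma inner_toEuclideanLin_transpose (A : Matrix (Fin n) (Fin n) ℝ) (x y : Euc n) :
    ⟪toEuclideanLin A.transpose x, y⟫_ℝ = ⟪x, toEuclideanLin A y⟫_ℝ := by
  rw [← conjTranspose_eq_transpose_of_trivial, toEuclideanLin_conjTranspose_eq_adjoint,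
    LinearMap.adjoint_inner_left]

/-- The range of `A` contains the nonempty open set `V`, so it is the whole space. -/
lemma IsCone.det_ne_zero (hV : IsCone V) {A : Matrix (Fin n) (Fin n) ℝ} (hA : A ∈ autGroup V) :
    A.det ≠ 0 := by
  have hr : LinearMap.range (Matrix.toEuclideanLin A) = ⊤ := by
    apply Submodule.eq_top_of_nonempty_interior'
    obtain ⟨x, hx⟩ := hV.nonempty
    refine ⟨x, interior_maximal (fun y hy => ?_) hV.isOpen hx⟩
    rw [← (hA : _ '' V = V)] at hy
    obtain ⟨z, _, rfl⟩ := hy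
    exact ⟨z, rfl⟩
  rw [← LinearMap.det_toLpLin 2]
  intro h0
  exact (LinearMap.bot_lt_ker_of_det_eq_zero h0).ne' (LinearMap.ker_eq_bot_iff_range_eq_top.2 hr)

lemma toEuclideanLin_inv_apply {A : Matrix (Fin n) (Fin n) ℝ} (hA : A.det ≠ 0) (x : Euc n) :
    Matrix.toEuclideanLin A⁻¹ (Matrix.toEuclideanLin A x) = x := by
  rw [← toEuclideanLin_mul_apply, Matrix.nonsing_inv_mul _ (isUnit_iff_ne_zero.2 hA)]
  simp

lemma toEuclideanLin_apply_inv {A : Matrix (Fin n) (Fin n) ℝ} (hA : A.det ≠ 0) (x : Euc n) :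
    Matrix.toEuclideanLin A (Matrix.toEuclideanLin A⁻¹ x) = x := by
  rw [← toEuclideanLin_mul_apply, Matrix.mul_nonsing_inv _ (isUnit_iff_ne_zero.2 hA)]
  simp

lemma toEuclideanLin_injective {A : Matrix (Fin n) (Fin n) ℝ} (hA : A.det ≠ 0) :
    Function.Injective (Matrix.toEuclideanLin A : Euc n → Euc n) :=
  Function.LeftInverse.injective (toEuclideanLin_inv_apply hA)

lemma toEuclideanLin_mem {A : Matrix (Fin n) (Fin n) ℝ} (hA : A ∈ autGroup V) {x : Euc n}
    (hx : x ∈ V) : Matrix.toEuclideanLin A x ∈ V :=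
  (hA : _ '' V = V).subset (Set.mem_image_of_mem _ hx)

lemma IsCone.inv_mem_autGroup (hV : IsCone V) {A : Matrix (Fin n) (Fin n) ℝ}
    (hA : A ∈ autGroup V) : A⁻¹ ∈ autGroup V := by
  have hd := hV.det_ne_zero hA
  change _ '' V = V
  conv_lhs => rw [← (hA : _ '' V = V), Set.image_image]
  simp [toEuclideanLin_inv_apply hd]

lemma IsCone.toEuclideanLin_transpose_mem (hV : IsCone V) {A : Matrix (Fin n) (Fin n) ℝ}
    (hA : A ∈ autGroup V) {ξ : Euc n} (hξ : ξ ∈ dualCone V) :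
    Matrix.toEuclideanLin A.transpose ξ ∈ dualCone V := by
  intro y hy h0
  rw [inner_toEuclideanLin_transpose]
  refine hξ _ (map_mem_closure (LinearMap.continuous_of_finiteDimensional _) hy
    fun z hz => toEuclideanLin_mem hA hz) fun h => h0 ?_
  exact toEuclideanLin_injective (hV.det_ne_zero hA) (h.trans (map_zero _).symm)

lemma IsCone.contragredient_mem (hV : IsCone V) {A : Matrix (Fin n) (Fin n) ℝ}
    (hA : A ∈ autGroup V) {ξ : Euc n} (hξ : ξ ∈ dualCone V) :
    Matrix.toEuclideanLin A.transpose⁻¹ ξ ∈ dualCone V := by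
  rw [← Matrix.transpose_nonsing_inv]
  exact hV.toEuclideanLin_transpose_mem (hV.inv_mem_autGroup hA) hξ

lemma IsCone.contragredient_mem_autGroup (hV : IsCone V) {A : Matrix (Fin n) (Fin n) ℝ}
    (hA : A ∈ autGroup V) : A.transpose⁻¹ ∈ autGroup (dualCone V) := by
  have hd : A.transpose.det ≠ 0 := by simpa using hV.det_ne_zero hA
  refine Set.Subset.antisymm ?_ fun ξ hξ => ?_
  · rintro _ ⟨ξ, hξ, rfl⟩
    exact hV.contragredient_mem hA hξ
  · exact ⟨_, hV.toEuclideanLin_transpose_mem hA hξ, toEuclideanLin_inv_apply hd ξ⟩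

lemma inner_contragredient {A : Matrix (Fin n) (Fin n) ℝ} (hA : A.det ≠ 0) (ξ y : Euc n) :
    ⟪Matrix.toEuclideanLin A.transpose⁻¹ ξ, Matrix.toEuclideanLin A y⟫_ℝ = ⟪ξ, y⟫_ℝ := by
  rw [← inner_toEuclideanLin_transpose, toEuclideanLin_apply_inv (by simpa using hA)]

/-- `A` carries cone intervals onto cone intervals. The set `W` is arbitrary so as to cover both `V`
and `V*`. -/
lemma coneDelta_toEuclideanLin {W : Set (Euc n)} {A : Matrix (Fin n) (Fin n) ℝ}
    (hd : A.det ≠ 0) (hA : A ∈ autGroup W) (x : Euc n) :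
    coneDelta W (Matrix.toEuclideanLin A x) = ENNReal.ofReal |A.det| * coneDelta W x := by
  have h : coneInterval W 0 (Matrix.toEuclideanLin A x)
      = Matrix.toEuclideanLin A '' coneInterval W 0 x := by
    have hiff : ∀ z, Matrix.toEuclideanLin A z ∈ W ↔ z ∈ W := fun z => by
      have h := (toEuclideanLin_injective hd).mem_set_image (s := W) (a := z)
      rwa [(hA : _ '' W = W)] at h
    refine Set.Subset.antisymm (fun y hy => ?_) ?_
    · obtain ⟨z, rfl⟩ : ∃ z, Matrix.toEuclideanLin A z = y := ⟨_, toEuclideanLin_apply_inv hd y⟩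
      refine ⟨z, ?_, rfl⟩
      simpa only [coneInterval, Set.mem_ofPred_eq, sub_zero, ← map_sub, hiff] using hy
    · rintro _ ⟨z, hz, rfl⟩
      simpa only [coneInterval, Set.mem_ofPred_eq, sub_zero, ← map_sub, hiff] using hz
  rw [coneDelta, h, Measure.addHaar_image_linearMap, LinearMap.det_toLpLin]
  rfl

lemma hasFDerivWithinAt_toEuclideanLin (A : Matrix (Fin n) (Fin n) ℝ) (s : Set (Euc n))
    (x : Euc n) : HasFDerivWithinAt (Matrix.toEuclideanLin A)
      (LinearMap.toContinuousLinearMap (Matrix.toEuclideanLin A)) s x :=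
  (LinearMap.toContinuousLinearMap (Matrix.toEuclideanLin A)).hasFDerivWithinAt

lemma IsCone.setLIntegral_comp (hV : IsCone V) {A : Matrix (Fin n) (Fin n) ℝ}
    (hA : A ∈ autGroup V) (g : Euc n → ℝ≥0∞) :
    ∫⁻ y in V, g y = ENNReal.ofReal |A.det| * ∫⁻ y in V, g (Matrix.toEuclideanLin A y) := by
  have h := lintegral_image_eq_lintegral_abs_det_fderiv_mul volume hV.isOpen.measurableSet
    (fun x _ => hasFDerivWithinAt_toEuclideanLin A V x)
    (toEuclideanLin_injective (hV.det_ne_zero hA)).injOn g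
  rw [(hA : _ '' V = V)] at h
  rw [h, ← lintegral_const_mul' _ _ ENNReal.ofReal_ne_top]
  simp [ContinuousLinearMap.det, LinearMap.det_toLpLin]

lemma IsCone.dualChar_contragredient (hV : IsCone V) {A : Matrix (Fin n) (Fin n) ℝ}
    (hA : A ∈ autGroup V) (ξ : Euc n) :
    dualChar V (Matrix.toEuclideanLin A.transpose⁻¹ ξ) = |A.det| * dualChar V ξ := by
  have h := integral_image_eq_integral_abs_det_fderiv_smul volume hV.isOpen.measurableSet
    (fun x _ => hasFDerivWithinAt_toEuclideanLin A V x)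
    (toEuclideanLin_injective (hV.det_ne_zero hA)).injOn
    (fun y => Real.exp (-⟪Matrix.toEuclideanLin A.transpose⁻¹ ξ, y⟫_ℝ))
  rw [(hA : _ '' V = V)] at h
  rw [dualChar, h, dualChar, ← integral_const_mul]
  simp [ContinuousLinearMap.det, LinearMap.det_toLpLin, inner_contragredient (hV.det_ne_zero hA)]

lemma IsCone.smul_mem_autGroup (hV : IsCone V) {A : Matrix (Fin n) (Fin n) ℝ}
    (hA : A ∈ autGroup V) {r : ℝ} (hr : 0 < r) : r • A ∈ autGroup V := by
  refine Set.Subset.antisymm ?_ fun y hy => ?_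
  · rintro _ ⟨y, hy, rfl⟩
    simpa using hV.smul_mem _ (toEuclideanLin_mem hA hy) r hr
  · have := hV.smul_mem y hy r⁻¹ (inv_pos.2 hr)
    rw [← (hA : _ '' V = V)] at this
    obtain ⟨z, hz, h⟩ := this
    refine ⟨z, hz, ?_⟩
    rw [map_smul, LinearMap.smul_apply, h, smul_inv_smul₀ hr.ne']

/-- Otherwise `V` contains a ball about `0`, hence opposite vectors. In dimension `0` the claim
fails. -/
lemma IsCone.ne_zero [Nonempty (Fin n)] (hV : IsCone V) {x : Euc n} (hx : x ∈ V) : x ≠ 0 := by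
  rintro rfl
  obtain ⟨u, hu⟩ := exists_ne (0 : Euc n)
  have hev : ∀ v : Euc n, ∀ᶠ t : ℝ in nhdsWithin 0 (Set.Ioi 0), t • v ∈ V := fun v => by
    have hc : Filter.Tendsto (fun t : ℝ => t • v) (nhds 0) (nhds 0) := by
      have : Continuous fun t : ℝ => t • v := by fun_prop
      simpa using this.tendsto 0
    exact (hc.eventually (hV.isOpen.mem_nhds hx)).filter_mono nhdsWithin_le_nhds
  obtain ⟨t, ⟨h1, h2⟩, ht⟩ := (((hev u).and (hev (-u))).and self_mem_nhdsWithin).exists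
  refine hV.pointed _ (subset_closure h1) (smul_ne_zero (ne_of_gt ht) hu) ?_
  rw [← smul_neg]
  exact subset_closure h2

/-- The contragredient action of `G(V)` on the dual of a homogeneous cone is transitive. -/
theorem IsHomogeneousCone.exists_contragredient_eq (hV : IsHomogeneousCone V) {ξ₁ ξ₂ : Euc n}
    (h₁ : ξ₁ ∈ dualCone V) (h₂ : ξ₂ ∈ dualCone V) :
    ∃ A ∈ autGroup V, Matrix.toEuclideanLin A.transpose⁻¹ ξ₁ = ξ₂ := by
  have hC := hV.toIsCone
  obtain ⟨x₁, hx₁, hmin₁⟩ := hC.exists_mem_forall_lt h₁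
  obtain ⟨x₂, hx₂, hmin₂⟩ := hC.exists_mem_forall_lt h₂
  obtain ⟨A, hA, hAx⟩ := hV.transitive x₁ hx₁ x₂ hx₂
  rcases isEmpty_or_nonempty (Fin n) with he | hne
  · exact ⟨A, hA, Subsingleton.elim _ _⟩
  have hpos : ∀ ξ ∈ dualCone V, ∀ x ∈ V, 0 < ⟪ξ, x⟫_ℝ := fun ξ hξ x hx =>
    hξ x (subset_closure hx) (hC.ne_zero hx)
  -- With this ratio as `r`, the contragredient of `r • A` sends the slice through `ξ₁` to the slice
  -- through `ξ₂`.
  have hr : 0 < ⟪ξ₁, x₁⟫_ℝ / ⟪ξ₂, x₂⟫_ℝ := div_pos (hpos _ h₁ _ hx₁) (hpos _ h₂ _ hx₂)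
  obtain ⟨r, hr0⟩ : ∃ r, r = ⟪ξ₁, x₁⟫_ℝ / ⟪ξ₂, x₂⟫_ℝ := ⟨_, rfl⟩
  rw [← hr0] at hr
  rw [eq_div_iff (hpos _ h₂ _ hx₂).ne'] at hr0
  have hB := hC.smul_mem_autGroup hA hr
  have hdB := hC.det_ne_zero hB
  refine ⟨r • A, hB, ?_⟩
  have hη := hC.contragredient_mem hB h₁
  have hBx : Matrix.toEuclideanLin (r • A) x₁ = r • x₂ := by simp [hAx]
  have hslice : r * ⟪Matrix.toEuclideanLin (r • A).transpose⁻¹ ξ₁, x₂⟫_ℝ = r * ⟪ξ₂, x₂⟫_ℝ := by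
    rw [← inner_smul_right, ← hBx, inner_contragredient hdB, hr0]
  have hslice' := mul_left_cancel₀ hr.ne' hslice
  -- Minimality at `ξ₂`, and at `ξ₁` after pulling `ξ₂` back, gives opposite strict inequalities,
  -- since the action multiplies `φ` by a constant.
  by_contra hcon
  have hlt₂ := hmin₂ _ hη (by rw [real_inner_comm, hslice', real_inner_comm]) hcon
  have hd' : (r • A).transpose.det ≠ 0 := by rwa [Matrix.det_transpose]
  have hζ := hC.toEuclideanLin_transpose_mem hB h₂
  have hlt₁ := hmin₁ (Matrix.toEuclideanLin (r • A).transpose ξ₂) hζ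
    (by rw [real_inner_comm, inner_toEuclideanLin_transpose, hBx, inner_smul_right, hr0,
      real_inner_comm])
    (fun h => hcon (by rw [← h, toEuclideanLin_inv_apply hd']))
  have e := hC.dualChar_contragredient hB (Matrix.toEuclideanLin (r • A).transpose ξ₂)
  rw [toEuclideanLin_inv_apply hd'] at e
  rw [hC.dualChar_contragredient hB, e] at hlt₂
  exact lt_asymm hlt₁ (lt_of_mul_lt_mul_left hlt₂ (abs_nonneg _))

/-! ### Positivity, finiteness and measurability of `Δ` -/

lemma IsCone.coneDelta_ne_zero (hV : IsCone V) {y : Euc n} (hy : y ∈ V) : coneDelta V y ≠ 0 := by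
  have ho : IsOpen (coneInterval V 0 y) :=
    hV.isOpen.inter ((hV.isOpen.preimage (f := fun x => x - 0) (by fun_prop)).inter
      (hV.isOpen.preimage (f := fun x => y - x) (by fun_prop)))
  have hh : (1 / 2 : ℝ) • y ∈ V := hV.smul_mem y hy _ (by norm_num)
  have he : y - (1 / 2 : ℝ) • y = (1 / 2 : ℝ) • y := by module
  exact (ho.measure_pos volume ⟨(1 / 2 : ℝ) • y, hh, by rwa [sub_zero], by rwa [he]⟩).ne'

/-- On the interval `⟪ξ, x⟫ ≤ ⟪ξ, y⟫`, so coercivity of `ξ` bounds `‖x‖`. -/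
lemma IsCone.coneDelta_ne_top (hV : IsCone V) {ξ : Euc n} (hξ : ξ ∈ dualCone V) (y : Euc n) :
    coneDelta V y ≠ ∞ := by
  obtain ⟨c, hc, h⟩ := hV.exists_pos_mul_norm_le hξ
  refine (lt_of_le_of_lt (measure_mono fun x hx => ?_)
    (measure_closedBall_lt_top (μ := volume) (x := (0 : Euc n)) (r := ⟪ξ, y⟫_ℝ / c))).ne
  have h1 := h x (subset_closure hx.1)
  have h2 := inner_nonneg_of_mem_dualCone hξ hx.2.2
  rw [inner_sub_right] at h2
  rw [mem_closedBall_zero_iff, le_div_iff₀ hc]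
  linarith

lemma IsCone.coneDelta_dualCone_ne_top (hV : IsCone V) (ξ : Euc n) :
    coneDelta (dualCone V) ξ ≠ ∞ := by
  obtain ⟨v, hv⟩ := hV.nonempty
  obtain ⟨r, hr, hball⟩ := Metric.isOpen_iff.1 hV.isOpen v hv
  refine (lt_of_le_of_lt (measure_mono fun η hη => ?_)
    (measure_closedBall_lt_top (μ := volume) (x := (0 : Euc n)) (r := ⟪ξ, v⟫_ℝ / (r / 2)))).ne
  rw [mem_closedBall_zero_iff, le_div_iff₀ (by positivity)]
  have h2 := inner_nonneg_of_mem_dualCone hη.2.2 hv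
  rw [inner_sub_left] at h2
  by_cases h0 : η = 0
  · subst h0
    simpa using h2
  have hn : 0 < ‖η‖ := norm_pos_iff.2 h0
  -- Stepping `r / 2` from `v` against `η` stays in the ball, which yields `‖η‖ * (r / 2) ≤ ⟪η, v⟫`.
  have hw : v - (r / 2 / ‖η‖) • η ∈ V := hball (by
    rw [Metric.mem_ball, dist_eq_norm, sub_sub_cancel_left, norm_neg, norm_smul, Real.norm_eq_abs,
      abs_of_pos (by positivity), div_mul_cancel₀ _ hn.ne']
    linarith)
  have h1 := inner_nonneg_of_mem_dualCone hη.1 hw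
  rw [inner_sub_right, inner_smul_right, real_inner_self_eq_norm_sq, div_mul_eq_mul_div, sq,
    ← mul_assoc, mul_div_cancel_right₀ _ hn.ne'] at h1
  linarith

lemma IsCone.measurable_coneDelta (hV : IsCone V) : Measurable (coneDelta V) := by
  have hs : MeasurableSet {q : Euc n × Euc n | q.2 ∈ V ∧ q.2 - 0 ∈ V ∧ q.1 - q.2 ∈ V} :=
    (hV.isOpen.measurableSet.preimage measurable_snd).inter
      ((hV.isOpen.measurableSet.preimage (f := fun q : Euc n × Euc n => q.2 - 0)
        (by fun_prop)).inter
        (hV.isOpen.measurableSet.preimage (f := fun q : Euc n × Euc n => q.1 - q.2)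
          (by fun_prop)))
  exact measurable_measure_prodMk_left hs

/-! ### Hölder's inequality and scaling laws -/

/-- The weighted `L^p` norm on the right-hand side of the estimate. -/
noncomputable def weightedNorm (V : Set (Euc n)) (p β : ℝ) (f : Euc n → ℝ≥0) : ℝ≥0∞ :=
  (∫⁻ y in V, (f y : ℝ≥0∞) ^ p * coneDelta V y ^ (β * p - 1)) ^ (1 / p)

/-- Hölder's inequality for the integral operator at a fixed point of the dual cone. -/
lemma IsCone.exists_kernelOp_le (hV : IsCone V) {p β : ℝ} (hp : 1 ≤ p) {k : Euc n → Euc n → ℝ≥0}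
    (hk : KernelCondition V p β k) {ξ : Euc n} (hξ : ξ ∈ dualCone V)
    (hk_meas : AEMeasurable (k ξ) (volume.restrict V)) :
    ∃ C : ℝ≥0∞, C ≠ ∞ ∧ ∀ f : Euc n → ℝ≥0, Measurable f →
      kernelOp V k f ξ ≤ C * weightedNorm V p β f := by
  have hΔ := hV.measurable_coneDelta
  rcases hp.eq_or_lt with rfl | hp
  · refine ⟨_, (hk.2 rfl ξ hξ).ne, fun f _ => ?_⟩
    rw [weightedNorm, one_div_one, ENNReal.rpow_one,
      ← lintegral_const_mul' _ _ (hk.2 rfl ξ hξ).ne]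
    refine lintegral_mono_ae ?_
    filter_upwards [ENNReal.ae_le_essSup (μ := volume.restrict V)
      (fun y => (k ξ y : ℝ≥0∞) * coneDelta V y ^ (1 - β)),
      ae_restrict_mem hV.isOpen.measurableSet] with y hy hyV
    refine le_trans (le_of_eq ?_) (mul_le_mul_left hy _)
    rw [ENNReal.rpow_one, mul_one, mul_mul_mul_comm,
      ← ENNReal.rpow_add _ _ (hV.coneDelta_ne_zero hyV) (hV.coneDelta_ne_top hξ y),
      sub_add_sub_cancel, sub_self, ENNReal.rpow_zero, mul_one]
  · have hpq := Real.HolderConjugate.conjExponent hp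
    have hq : Real.conjExponent p = p / (p - 1) := rfl
    rw [hq] at hpq
    set q := p / (p - 1) with hqdef
    have hq0 : 0 < q := hpq.symm.pos
    have hp0 : 0 < p := hpq.pos
    have hsum : 1 / p + 1 / q = 1 := by simpa using hpq.inv_add_inv_eq_one
    refine ⟨(∫⁻ y in V, (k ξ y : ℝ≥0∞) ^ q * coneDelta V y ^ ((1 - β) * q - 1)) ^ (1 / q),
      ENNReal.rpow_ne_top_of_nonneg (by positivity) (hk.1 hp ξ hξ).ne, fun f hf => ?_⟩
    -- The powers of `Δ_V` in the two factors have exponents summing to `0`, so they cancel in the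
    -- product.
    have hH := ENNReal.lintegral_mul_le_Lp_mul_Lq (volume.restrict V) hpq.symm
      (f := fun y => (k ξ y : ℝ≥0∞) * coneDelta V y ^ (1 - β - 1 / q))
      (g := fun y => (f y : ℝ≥0∞) * coneDelta V y ^ (β - 1 / p))
      (hk_meas.coe_nnreal_ennreal.mul (hΔ.pow_const _).aemeasurable)
      (hf.coe_nnreal_ennreal.mul (hΔ.pow_const _)).aemeasurable
    have e1 : ∀ y, ((k ξ y : ℝ≥0∞) * coneDelta V y ^ (1 - β - 1 / q)) ^ q
        = (k ξ y : ℝ≥0∞) ^ q * coneDelta V y ^ ((1 - β) * q - 1) := fun y => by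
      rw [ENNReal.mul_rpow_of_nonneg _ _ hq0.le, ← ENNReal.rpow_mul, sub_mul,
        one_div_mul_cancel hq0.ne']
    have e2 : ∀ y, ((f y : ℝ≥0∞) * coneDelta V y ^ (β - 1 / p)) ^ p
        = (f y : ℝ≥0∞) ^ p * coneDelta V y ^ (β * p - 1) := fun y => by
      rw [ENNReal.mul_rpow_of_nonneg _ _ hp0.le, ← ENNReal.rpow_mul, sub_mul,
        one_div_mul_cancel hp0.ne']
    simp only [e1, e2] at hH
    refine le_trans (le_of_eq ?_) hH
    refine setLIntegral_congr_fun hV.isOpen.measurableSet fun y hyV => ?_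
    simp only [Pi.mul_apply]
    rw [mul_mul_mul_comm,
      ← ENNReal.rpow_add _ _ (hV.coneDelta_ne_zero hyV) (hV.coneDelta_ne_top hξ y)]
    have : 1 - β - 1 / q + (β - 1 / p) = 0 := by linarith
    rw [this, ENNReal.rpow_zero, mul_one]

/-- The substitution `y = Az` yields one factor `|det A|`, homogeneity of `k` the factor `|det
A|^β`. -/
lemma IsCone.kernelOp_contragredient (hV : IsCone V) {β : ℝ} {k : Euc n → Euc n → ℝ≥0}
    (hk : IsDualHomogeneousKernel V β k) {A : Matrix (Fin n) (Fin n) ℝ} (hA : A ∈ autGroup V)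
    {ξ : Euc n} (hξ : ξ ∈ dualCone V) (f : Euc n → ℝ≥0) :
    kernelOp V k f (Matrix.toEuclideanLin A.transpose⁻¹ ξ)
      = ENNReal.ofReal |A.det| * (ENNReal.ofReal |A.det| ^ β *
        kernelOp V k (fun y => f (Matrix.toEuclideanLin A y)) ξ) := by
  have hd : 0 < |A.det| := abs_pos.2 (hV.det_ne_zero hA)
  have hD : ENNReal.ofReal |A.det| ^ β ≠ ∞ :=
    ENNReal.rpow_ne_top_of_ne_zero (by simpa using hV.det_ne_zero hA) ENNReal.ofReal_ne_top
  rw [kernelOp, hV.setLIntegral_comp hA, kernelOp, ← lintegral_const_mul' _ _ hD]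
  congr 1
  refine setLIntegral_congr_fun hV.isOpen.measurableSet fun y hy => ?_
  have hne : Real.nnabs A.det ≠ 0 := by simpa using hV.det_ne_zero hA
  have hc : ((Real.nnabs A.det : ℝ≥0) : ℝ≥0∞) = ENNReal.ofReal |A.det| := by
    rw [ENNReal.ofReal, ← Real.nnabs_of_nonneg (abs_nonneg _)]
    simp
  simp only [hk A hA ξ hξ y hy]
  rw [ENNReal.coe_mul, ENNReal.coe_rpow_of_ne_zero hne, hc, mul_assoc]

lemma IsCone.weightedNorm_eq (hV : IsCone V) {p β : ℝ} (hp : 1 ≤ p)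
    {A : Matrix (Fin n) (Fin n) ℝ} (hA : A ∈ autGroup V) (f : Euc n → ℝ≥0) :
    weightedNorm V p β f = ENNReal.ofReal |A.det| ^ β *
      weightedNorm V p β (fun y => f (Matrix.toEuclideanLin A y)) := by
  have hp0 : 0 < p := by linarith
  have hd := hV.det_ne_zero hA
  have hD0 : ENNReal.ofReal |A.det| ≠ 0 := by simpa using hd
  have hDt : ENNReal.ofReal |A.det| ≠ ∞ := ENNReal.ofReal_ne_top
  have h : ∀ y, (f (Matrix.toEuclideanLin A y) : ℝ≥0∞) ^ p *
      coneDelta V (Matrix.toEuclideanLin A y) ^ (β * p - 1) = ENNReal.ofReal |A.det| ^ (β * p - 1) *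
        ((f (Matrix.toEuclideanLin A y) : ℝ≥0∞) ^ p * coneDelta V y ^ (β * p - 1)) := fun y => by
    rw [coneDelta_toEuclideanLin hd hA, ENNReal.mul_rpow_eq_ite]
    simp [hD0, hDt, mul_left_comm]
  rw [weightedNorm, hV.setLIntegral_comp hA, lintegral_congr h,
    lintegral_const_mul' _ _ (ENNReal.rpow_ne_top_of_ne_zero hD0 hDt), ← mul_assoc,
    ENNReal.mul_rpow_of_nonneg _ _ (by positivity), ← weightedNorm]
  congr 1
  -- Jacobian and weight combine to exponent `1 + (βp - 1) = βp`, whose `p`-th root gives `β`.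
  nth_rewrite 1 [← ENNReal.rpow_one (ENNReal.ofReal |A.det|)]
  rw [← ENNReal.rpow_add _ _ hD0 hDt, ← ENNReal.rpow_mul]
  congr 1
  field_simp
  ring

end HomCone

/-! ### The weighted estimate -/

theorem theorem3p11 {n : ℕ} (V : Set (HomCone.Euc n)) (hV : HomCone.IsHomogeneousCone V)
    (p β : ℝ) (hp : 1 ≤ p)
    (k : HomCone.Euc n → HomCone.Euc n → ℝ≥0)
    (hk_meas : ∀ x ∈ HomCone.dualCone V, AEMeasurable (k x) (volume.restrict V))
    (hk_hom : HomCone.IsDualHomogeneousKernel V β k)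
    (hk : HomCone.KernelCondition V p β k) :
    ∃ c : ℝ≥0, ∀ f : HomCone.Euc n → ℝ≥0, AEMeasurable f (volume.restrict V) →
      essSup (fun x => HomCone.coneDelta (HomCone.dualCone V) x * HomCone.kernelOp V k f x)
          (volume.restrict (HomCone.dualCone V))
        ≤ (c : ℝ≥0∞) *
          (∫⁻ y in V, (f y : ℝ≥0∞) ^ p * HomCone.coneDelta V y ^ (β * p - 1)) ^ (1 / p) := by
  have hC := hV.toIsCone
  rcases (HomCone.dualCone V).eq_empty_or_nonempty with he | ⟨ξ₀, hξ₀⟩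
  · exact ⟨0, fun f _ => by simp [he]⟩
  obtain ⟨C, hCtop, hHolder⟩ := hC.exists_kernelOp_le hp hk hξ₀ (hk_meas ξ₀ hξ₀)
  have hctop : HomCone.coneDelta (HomCone.dualCone V) ξ₀ * C ≠ ∞ :=
    ENNReal.mul_ne_top (hC.coneDelta_dualCone_ne_top ξ₀) hCtop
  refine ⟨(HomCone.coneDelta (HomCone.dualCone V) ξ₀ * C).toNNReal, fun f hf => ?_⟩
  rw [ENNReal.coe_toNNReal hctop]
  refine essSup_le_of_ae_le _
    (ae_restrict_of_forall_mem hC.isOpen_dualCone.measurableSet fun ξ hξ => ?_)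
  -- Both sides see `f` only up to null sets; a measurable representative keeps `g ∘ A` measurable
  -- for Hölder.
  obtain ⟨g, hg, hfg⟩ := hf
  have hK : HomCone.kernelOp V k f ξ = HomCone.kernelOp V k g ξ :=
    lintegral_congr_ae (hfg.mono fun y hy => by simp only [hy])
  have hN : (∫⁻ y in V, (f y : ℝ≥0∞) ^ p * HomCone.coneDelta V y ^ (β * p - 1)) ^ (1 / p)
      = HomCone.weightedNorm V p β g := by
    congr 1
    exact lintegral_congr_ae (hfg.mono fun y hy => by simp only [hy])
  simp only [hK, hN]
  obtain ⟨A, hA, rfl⟩ := hV.exists_contragredient_eq hξ₀ hξ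
  have hd := hC.det_ne_zero hA
  have hdt : A.transpose⁻¹.det ≠ 0 := by
    simpa [Matrix.det_nonsing_inv] using hd
  have hD0 : ENNReal.ofReal |A.det| ≠ 0 := by simpa using hd
  have hdet : ENNReal.ofReal |A.transpose⁻¹.det| = (ENNReal.ofReal |A.det|)⁻¹ := by
    rw [Matrix.det_nonsing_inv, Matrix.det_transpose, Ring.inverse_eq_inv', abs_inv,
      ENNReal.ofReal_inv_of_pos (abs_pos.2 hd)]
  rw [HomCone.coneDelta_toEuclideanLin hdt (hC.contragredient_mem_autGroup hA), hdet,
    hC.kernelOp_contragredient hk_hom hA hξ₀, hC.weightedNorm_eq hp hA g]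
  have hgA : Measurable fun y => g (Matrix.toEuclideanLin A y) :=
    hg.comp (LinearMap.continuous_of_finiteDimensional _).measurable
  calc _ = ((ENNReal.ofReal |A.det|)⁻¹ * ENNReal.ofReal |A.det|) *
        (HomCone.coneDelta (HomCone.dualCone V) ξ₀ * (ENNReal.ofReal |A.det| ^ β *
          HomCone.kernelOp V k (fun y => g (Matrix.toEuclideanLin A y)) ξ₀)) := by ring
    _ ≤ HomCone.coneDelta (HomCone.dualCone V) ξ₀ * (ENNReal.ofReal |A.det| ^ β *
          (C * HomCone.weightedNorm V p β (fun y => g (Matrix.toEuclideanLin A y)))) := by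
        rw [ENNReal.inv_mul_cancel hD0 ENNReal.ofReal_ne_top, one_mul]
        gcongr
        exact hHolder _ hgA
    _ = _ := by ring
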